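/- Let $\zeta$ denote the Riemann zeta function, and for $n\in\{3,4\}$ let $s(n)=\sum_{k=1}^{\infty}\frac{1}{k^{n}}\binom{2k}{k}\frac{1}{4^{k}}$. Both series converge, and $$s(3)=\sum_{k=1}^{\infty}\frac{1}{k^{3}}\binom{2k}{k}\frac{1}{4^{k}}=2\zeta(3)-2\ln(2)\,\zeta(2)+\frac{4}{3}(\ln 2)^{3},$$ $$s(4)=\sum_{k=1}^{\infty}\frac{1}{k^{4}}\binom{2k}{k}\frac{1}{4^{k}}=\frac{9}{4}\zeta(4)-4\ln(2)\,\zeta(3)+2(\ln 2)^{2}\zeta(2)-\frac{2}{3}(\ln 2)^{4}.$$ -/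

import Mathlib

open Filter Topology

/-! Write B_n(z), G(z), E_n(z) for `binomSum`, `gammaQuotient`, `etaSum`. Since G = 1 + z B_1 is a
quotient of Gamma functions, G'/G is a difference of digamma values, namely E_1. This is proved
without Gamma: `gammaQuotient_recurrence` relates G(z) to G(z + 1), its logarithmic derivative
telescopes, and the remainder vanishes at infinity (`hasSum_etaSum_one`). Differentiating G' = G E_1
up to three times at 0 expresses B_1(0), ..., B_4(0) through the E_n(0) (`binomSum_zero_relations`).
Here E_1(0) = 2 log 2 and E_n(0) = (2^n - 2) ζ(n) for n ≥ 2; for B_4 the term ζ(2)^2 becomes 5/2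
ζ(4). -/

/-- The normalised central binomial coefficient `binom(2k, k) / 4 ^ k`. -/
noncomputable def centralCoeff (k : ℕ) : ℝ := (Nat.choose (2 * k) k : ℝ) / 4 ^ k

lemma centralCoeff_pos (k : ℕ) : 0 < centralCoeff k := by
  have : 0 < Nat.choose (2 * k) k := Nat.choose_pos (by omega)
  unfold centralCoeff
  positivity

lemma centralCoeff_zero : centralCoeff 0 = 1 := by simp [centralCoeff]

lemma centralCoeff_succ (k : ℕ) :
    centralCoeff (k + 1) * (k + 1) = centralCoeff k * (k + 1 / 2) := by
  have h : ((k : ℝ) + 1) * (Nat.choose (2 * (k + 1)) (k + 1) : ℝ)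
      = 2 * (2 * k + 1) * (Nat.choose (2 * k) k : ℝ) := by
    have := Nat.succ_mul_centralBinom_succ k
    simp only [Nat.centralBinom] at this
    exact_mod_cast this
  unfold centralCoeff
  rw [pow_succ]
  field_simp
  linear_combination 2 * h

/-- The left side decreases in k, because (2k + 1)(2k + 3) ≤ (2k + 2)^2. -/
lemma centralCoeff_sq_le (k : ℕ) : centralCoeff k ^ 2 * (2 * k + 1) ≤ 1 := by
  induction k with
  | zero => simp [centralCoeff_zero]
  | succ k ih =>
    have h : centralCoeff (k + 1) = centralCoeff k * (k + 1 / 2) / (k + 1) := by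
      rw [eq_div_iff (by positivity), centralCoeff_succ]
    refine le_trans ?_ ih
    rw [h, div_pow, mul_pow, div_mul_eq_mul_div, div_le_iff₀ (by positivity)]
    push_cast
    have := sq_nonneg (centralCoeff k)
    have hk : (0 : ℝ) ≤ k := k.cast_nonneg
    nlinarith [mul_nonneg this hk]

lemma tendsto_centralCoeff : Tendsto centralCoeff atTop (𝓝 0) := by
  have h : Tendsto (fun k => centralCoeff k ^ 2) atTop (𝓝 0) := by
    refine squeeze_zero (fun k => sq_nonneg _) (fun k => ?_)
      (tendsto_one_div_add_atTop_nhds_zero_nat (𝕜 := ℝ))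
    rw [le_div_iff₀ (by positivity)]
    have := centralCoeff_sq_le k
    have hk : (0 : ℝ) ≤ k := k.cast_nonneg
    nlinarith [mul_nonneg (sq_nonneg (centralCoeff k)) hk]
  have h2 := h.sqrt
  simpa [Real.sqrt_sq (centralCoeff_pos _).le] using h2

/-- Telescoping of a sequence tending to zero. -/
lemma hasSum_sub_of_tendsto_zero {T : ℕ → ℝ} (hT : Tendsto T atTop (𝓝 0)) {f : ℕ → ℝ}
    (hf : Summable f) (h : ∀ k, f k = T (k + 1) - T k) : HasSum f (-T 0) := by
  rw [hf.hasSum_iff_tendsto_nat]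
  simp_rw [h, Finset.sum_range_sub]
  simpa using hT.sub_const (T 0)

lemma summable_centralCoeff_div : Summable fun k : ℕ => centralCoeff (k + 1) / (k + 1 : ℝ) := by
  have h : HasSum (fun k : ℕ => centralCoeff k - centralCoeff (k + 1)) 1 := by
    rw [hasSum_iff_tendsto_nat_of_nonneg]
    · simp_rw [Finset.sum_range_sub']
      simpa [centralCoeff_zero] using tendsto_centralCoeff.const_sub (centralCoeff 0)
    · intro k
      have := centralCoeff_succ k
      nlinarith [centralCoeff_pos (k + 1), centralCoeff_pos k, (k.cast_nonneg : (0 : ℝ) ≤ k)]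
  -- The recurrence gives c_k - c_(k+1) = c_k / (2(k + 1)), hence the factor 2.
  refine Summable.of_nonneg_of_le (fun k => ?_) (fun k => ?_) (h.summable.mul_left 2)
  · have := centralCoeff_pos (k + 1)
    positivity
  · rw [div_le_iff₀ (by positivity)]
    have := centralCoeff_succ k
    have hk : (0 : ℝ) ≤ k := k.cast_nonneg
    have h1 := centralCoeff_pos k
    have h2 := centralCoeff_pos (k + 1)
    have h3 : centralCoeff (k + 1) ≤ centralCoeff k := by nlinarith
    nlinarith

/-! ### Shifted binomial sums and their derivatives -/

/-- The shifted sums `∑_{k ≥ 1} binom(2k, k) / (4 ^ k (k + z) ^ n)`. -/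
noncomputable def binomSum (n : ℕ) (z : ℝ) : ℝ :=
  ∑' k : ℕ, centralCoeff (k + 1) / (k + 1 + z) ^ n

lemma binomSum_shift_lower {z : ℝ} (hz : -1 / 2 < z) (k : ℕ) :
    ((k : ℝ) + 1) / 2 ≤ k + 1 + z := by
  have hk : (0 : ℝ) ≤ k := k.cast_nonneg
  linarith

/-- The bound does not depend on z, so it serves both for termwise differentiation and for dominated
convergence. -/
lemma binomSum_term_le {n : ℕ} (hn : 1 ≤ n) {z : ℝ} (hz : -1 / 2 < z) (k : ℕ) :
    centralCoeff (k + 1) / (k + 1 + z) ^ n ≤ 2 ^ n * (centralCoeff (k + 1) / (k + 1 : ℝ)) := by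
  have h := binomSum_shift_lower hz k
  have h2 := centralCoeff_pos (k + 1)
  calc centralCoeff (k + 1) / (k + 1 + z) ^ n
      ≤ centralCoeff (k + 1) / (((k : ℝ) + 1) / 2) ^ n := by gcongr
    _ = 2 ^ n * (centralCoeff (k + 1) / (k + 1 : ℝ) ^ n) := by rw [div_pow]; field_simp
    _ ≤ 2 ^ n * (centralCoeff (k + 1) / (k + 1 : ℝ)) := by
      gcongr
      exact le_self_pow₀ (by linarith [(k.cast_nonneg : (0 : ℝ) ≤ k)]) (by omega)

lemma binomSum_term_nonneg (n : ℕ) {z : ℝ} (hz : -1 / 2 < z) (k : ℕ) :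
    0 ≤ centralCoeff (k + 1) / (k + 1 + z) ^ n := by
  have h := binomSum_shift_lower hz k
  have h2 := centralCoeff_pos (k + 1)
  have : (0 : ℝ) < k + 1 + z := lt_of_lt_of_le (by positivity) h
  positivity

lemma summable_binomSum {n : ℕ} (hn : 1 ≤ n) {z : ℝ} (hz : -1 / 2 < z) :
    Summable fun k : ℕ => centralCoeff (k + 1) / (k + 1 + z) ^ n :=
  Summable.of_nonneg_of_le (binomSum_term_nonneg n hz) (binomSum_term_le hn hz)
    (summable_centralCoeff_div.mul_left _)

lemma hasDerivAt_const_div_add_pow (n : ℕ) (a c z : ℝ) (h : c + z ≠ 0) :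
    HasDerivAt (fun z => a / (c + z) ^ n) (-n * (a / (c + z) ^ (n + 1))) z := by
  have h1 : HasDerivAt (fun z => (c + z) ^ n) (n * (c + z) ^ (n - 1) * 1) z :=
    ((hasDerivAt_id z).const_add c).pow n
  refine ((hasDerivAt_const z a).div h1 (pow_ne_zero n h)).congr_deriv ?_
  rcases n with _ | n
  · simp
  · simp only [Nat.add_sub_cancel]
    field_simp
    ring

lemma hasDerivAt_binomSum {n : ℕ} (hn : 1 ≤ n) {z : ℝ} (hz : -1 / 2 < z) :
    HasDerivAt (binomSum n) (-n * binomSum (n + 1) z) z := by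
  have key := hasDerivAt_tsum_of_isPreconnected (𝕜 := ℝ)
    (g := fun (k : ℕ) z => centralCoeff (k + 1) / ((k : ℝ) + 1 + z) ^ n)
    (g' := fun (k : ℕ) z => -n * (centralCoeff (k + 1) / ((k : ℝ) + 1 + z) ^ (n + 1)))
    ((summable_centralCoeff_div.mul_left (2 ^ (n + 1))).mul_left (n : ℝ))
    isOpen_Ioi isPreconnected_Ioi (t := Set.Ioi (-1 / 2)) (y₀ := z) (y := z) (fun k y hy => ?_)
    (fun k y hy => ?_) hz (summable_binomSum hn hz) hz
  · rw [tsum_mul_left] at key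
    exact key
  · have h := binomSum_shift_lower hy k
    exact hasDerivAt_const_div_add_pow n _ _ _ (ne_of_gt (lt_of_lt_of_le (by positivity) h))
  · have h1 := binomSum_term_nonneg (n + 1) hy k
    rw [norm_mul, norm_neg, Real.norm_of_nonneg h1, Real.norm_of_nonneg (Nat.cast_nonneg n)]
    exact mul_le_mul_of_nonneg_left (binomSum_term_le (by omega) hy k) (Nat.cast_nonneg n)

/-! ### The Gamma quotient and its logarithmic derivative -/

/-- `∑_{k ≥ 0} binom(2k, k) z / (4 ^ k (k + z))`, with the term `k = 0` read as `1`;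
it equals `Γ(1 + z) Γ(1/2) / Γ(z + 1/2)`. -/
noncomputable def gammaQuotient (z : ℝ) : ℝ := 1 + z * binomSum 1 z

/-- The derivative of `gammaQuotient`. -/
noncomputable def gammaQuotientDeriv (z : ℝ) : ℝ := binomSum 1 z - z * binomSum 2 z

lemma hasDerivAt_gammaQuotient {z : ℝ} (hz : -1 / 2 < z) :
    HasDerivAt gammaQuotient (gammaQuotientDeriv z) z := by
  refine (((hasDerivAt_id z).mul (hasDerivAt_binomSum le_rfl hz)).const_add 1).congr_deriv ?_
  simp [gammaQuotientDeriv]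
  ring

lemma gammaQuotient_recurrence {z : ℝ} (hz : -1 / 2 < z) :
    (z + 1) * gammaQuotient z = (z + 1 / 2) * gammaQuotient (z + 1) := by
  have hz1 : -1 / 2 < z + 1 := by linarith
  have hpos : ∀ k : ℕ, (0 : ℝ) < k + 1 + z := fun k =>
    lt_of_lt_of_le (by positivity) (binomSum_shift_lower hz k)
  have key := hasSum_sub_of_tendsto_zero
    -- As (k + 2) c_(k+2) = (k + 3/2) c_(k+1), both T (k + 1) and T k are c_(k+1) minus a term of
    -- one of the two sums.
    (T := fun k : ℕ => (k + 1) * centralCoeff (k + 1) / (k + 1 + z))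
    (f := fun k : ℕ => z * (centralCoeff (k + 1) / (k + 1 + z) ^ 1)
      - (z + 1 / 2) * (centralCoeff (k + 1) / (k + 1 + (z + 1)) ^ 1)) ?_
    (((summable_binomSum le_rfl hz).mul_left _).sub ((summable_binomSum le_rfl hz1).mul_left _)) ?_
  · have h := key.unique (((summable_binomSum le_rfl hz).hasSum.mul_left z).sub
      ((summable_binomSum le_rfl hz1).hasSum.mul_left (z + 1 / 2)))
    have h1 := centralCoeff_succ 0
    norm_num [centralCoeff_zero] at h1
    have h2 := hpos 0
    norm_num [h1] at h
    norm_num at h2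
    simp only [gammaQuotient, binomSum, pow_one]
    field_simp at h
    linear_combination -h / 2
  · have h := (tendsto_centralCoeff.comp (tendsto_add_atTop_nat 1)).const_mul 2
    rw [mul_zero] at h
    refine squeeze_zero (fun k => ?_) (fun k => ?_) h
    · have := hpos k
      have := centralCoeff_pos (k + 1)
      positivity
    · rw [div_le_iff₀ (hpos k)]
      simp only [Function.comp]
      nlinarith [binomSum_shift_lower hz k, centralCoeff_pos (k + 1)]
  · intro k
    have h1 := centralCoeff_succ (k + 1)
    have h2 := hpos k
    have h3 := hpos (k + 1)
    push_cast at h1 h3 ⊢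
    rw [mul_comm ((k : ℝ) + 1 + 1) (centralCoeff _), h1]
    have h4 : (k : ℝ) + 1 + (z + 1) = k + 1 + 1 + z := by ring
    rw [h4]
    field_simp
    ring

lemma gammaQuotient_one_le {z : ℝ} (hz : 0 ≤ z) : 1 ≤ gammaQuotient z := by
  have : 0 ≤ binomSum 1 z := tsum_nonneg (binomSum_term_nonneg 1 (by linarith))
  unfold gammaQuotient
  nlinarith [mul_nonneg hz this]

/-- The recurrence carries positivity from z + 1 > 0 back to z. -/
lemma gammaQuotient_pos {z : ℝ} (hz : -1 / 2 < z) : 0 < gammaQuotient z := by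
  have h1 := gammaQuotient_recurrence hz
  have h2 := gammaQuotient_one_le (z := z + 1) (by linarith)
  have h3 : 0 < (z + 1) * gammaQuotient z := by
    rw [h1]; exact mul_pos (by linarith) (by linarith)
  exact pos_of_mul_pos_right h3 (by linarith)

lemma logDeriv_gammaQuotient_step {z : ℝ} (hz : -1 / 2 < z) :
    gammaQuotientDeriv z / gammaQuotient z = (1 / (1 / 2 + z) - 1 / (1 + z))
      + gammaQuotientDeriv (z + 1) / gammaQuotient (z + 1) := by
  have hz1 : -1 / 2 < z + 1 := by linarith
  have hL := ((hasDerivAt_id z).add_const 1).mul (hasDerivAt_gammaQuotient hz)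
  have hR := ((hasDerivAt_id z).add_const (1 / 2)).mul
    ((hasDerivAt_gammaQuotient hz1).comp_add_const z 1)
  have hev : (fun w => (w + 1) * gammaQuotient w)
      =ᶠ[𝓝 z] fun w => (w + 1 / 2) * gammaQuotient (w + 1) := by
    filter_upwards [Ioi_mem_nhds hz] with w hw using gammaQuotient_recurrence hw
  have h := hL.unique (hR.congr_of_eventuallyEq hev)
  simp only [id, one_mul] at h
  have hG := gammaQuotient_pos hz
  have hG1 := gammaQuotient_pos hz1
  have hr := gammaQuotient_recurrence hz
  have e1 : (0 : ℝ) < z + 1 := by linarith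
  have e2 : (0 : ℝ) < z + 1 / 2 := by linarith
  have e3 : 2 * z + 1 ≠ 0 := by linarith
  have e4 : z * 2 + 1 ≠ 0 := by linarith
  have hG1e : gammaQuotient (z + 1) = (z + 1) * gammaQuotient z / (z + 1 / 2) := by
    rw [hr]; field_simp
  have hD1 : gammaQuotientDeriv (z + 1) = (gammaQuotient z + (z + 1) * gammaQuotientDeriv z
      - gammaQuotient (z + 1)) / (z + 1 / 2) := by
    rw [h]; field_simp; ring
  rw [hD1, hG1e, add_comm (1 / 2 : ℝ) z, add_comm 1 z]
  field_simp
  ring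

lemma gammaQuotientDeriv_nonneg_le {z : ℝ} (hz : 0 ≤ z) :
    0 ≤ gammaQuotientDeriv z ∧ gammaQuotientDeriv z ≤ binomSum 1 z := by
  have hz' : -1 / 2 < z := by linarith
  have h2 : 0 ≤ binomSum 2 z := tsum_nonneg (binomSum_term_nonneg 2 hz')
  refine ⟨?_, by unfold gammaQuotientDeriv; nlinarith [mul_nonneg hz h2]⟩
  unfold gammaQuotientDeriv binomSum
  rw [← tsum_mul_left, sub_nonneg]
  refine Summable.tsum_le_tsum (fun k => ?_) ((summable_binomSum (by norm_num) hz').mul_left z)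
    (summable_binomSum le_rfl hz')
  have := centralCoeff_pos (k + 1)
  rw [← mul_div_assoc, div_le_div_iff₀ (by positivity) (by positivity)]
  have hk : (0 : ℝ) ≤ k := k.cast_nonneg
  have : 0 ≤ centralCoeff (k + 1) * (k + 1 + z) * (k + 1) := by positivity
  nlinarith

/-- For large arguments B_1 dominates G'/G, because 0 ≤ G' ≤ B_1 and G ≥ 1. -/
lemma tendsto_binomSum_one (z : ℝ) :
    Tendsto (fun N : ℕ => binomSum 1 (z + N)) atTop (𝓝 0) := by
  have hN : Tendsto (fun N : ℕ => z + (N : ℝ)) atTop atTop :=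
    tendsto_atTop_add_const_left _ _ tendsto_natCast_atTop_atTop
  have h := tendsto_tsum_of_dominated_convergence (𝓕 := atTop)
    (f := fun (N : ℕ) (k : ℕ) => centralCoeff (k + 1) / (k + 1 + (z + N)) ^ 1)
    (g := fun _ => 0) (summable_centralCoeff_div.mul_left (2 ^ 1)) (fun k => ?_) ?_
  · simpa [binomSum] using h
  · simp only [pow_one]
    exact (tendsto_atTop_add_const_left _ _ hN).const_div_atTop _
  · filter_upwards [hN.eventually_gt_atTop (-1 / 2)] with N hN k
    rw [Real.norm_of_nonneg (binomSum_term_nonneg 1 hN k)]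
    exact binomSum_term_le le_rfl hN k

lemma tendsto_logDeriv_gammaQuotient (z : ℝ) :
    Tendsto (fun N : ℕ => gammaQuotientDeriv (z + N) / gammaQuotient (z + N)) atTop (𝓝 0) := by
  have hN : Tendsto (fun N : ℕ => z + (N : ℝ)) atTop atTop :=
    tendsto_atTop_add_const_left _ _ tendsto_natCast_atTop_atTop
  refine squeeze_zero' ?_ ?_ (tendsto_binomSum_one z) <;>
  filter_upwards [hN.eventually_ge_atTop 0] with N hN
  · exact div_nonneg (gammaQuotientDeriv_nonneg_le hN).1 (by linarith [gammaQuotient_one_le hN])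
  · exact (div_le_self (gammaQuotientDeriv_nonneg_le hN).1 (gammaQuotient_one_le hN)).trans
      (gammaQuotientDeriv_nonneg_le hN).2

/-! ### The digamma-type sums and their values at 0 -/

/-- The sums `∑_{j ≥ 0} (1 / (j + 1/2 + z) ^ n - 1 / (j + 1 + z) ^ n)`. -/
noncomputable def etaSum (n : ℕ) (z : ℝ) : ℝ :=
  ∑' j : ℕ, (1 / (j + 1 / 2 + z) ^ n - 1 / (j + 1 + z) ^ n)

lemma hasSum_etaSum_one {z : ℝ} (hz : -1 / 2 < z) :
    HasSum (fun j : ℕ => 1 / (j + 1 / 2 + z) ^ 1 - 1 / (j + 1 + z) ^ 1)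
      (gammaQuotientDeriv z / gammaQuotient z) := by
  rw [hasSum_iff_tendsto_nat_of_nonneg]
  · have h : ∀ N : ℕ, ∑ j ∈ Finset.range N,
        (1 / ((j : ℝ) + 1 / 2 + z) ^ 1 - 1 / (j + 1 + z) ^ 1)
        = gammaQuotientDeriv z / gammaQuotient z
          - gammaQuotientDeriv (z + N) / gammaQuotient (z + N) := by
      intro N
      induction N with
      | zero => simp
      | succ N ih =>
        have hN : (0 : ℝ) ≤ N := N.cast_nonneg
        rw [Finset.sum_range_succ, ih, logDeriv_gammaQuotient_step (z := z + N) (by linarith)]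
        push_cast
        ring_nf
    simp_rw [h]
    simpa using (tendsto_logDeriv_gammaQuotient z).const_sub
      (gammaQuotientDeriv z / gammaQuotient z)
  · intro j
    have hj : (0 : ℝ) ≤ j := j.cast_nonneg
    rw [sub_nonneg, pow_one, pow_one]
    exact one_div_le_one_div_of_le (by linarith) (by linarith)

lemma gammaQuotientDeriv_eq {z : ℝ} (hz : -1 / 2 < z) :
    gammaQuotientDeriv z = gammaQuotient z * etaSum 1 z := by
  rw [etaSum, (hasSum_etaSum_one hz).tsum_eq, mul_div_cancel₀ _ (gammaQuotient_pos hz).ne']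

/-- Staying above -1/4 keeps the j = 0 term away from its pole at -1/2, so the bound is uniform in
z. -/
lemma etaSum_term_norm_le (n : ℕ) {z : ℝ} (hz : -1 / 4 < z) (j : ℕ) :
    ‖1 / ((j : ℝ) + 1 / 2 + z) ^ n - 1 / (j + 1 + z) ^ n‖ ≤ 2 * 4 ^ n * (1 / (j + 1 : ℝ) ^ n) := by
  have hj : (0 : ℝ) ≤ j := j.cast_nonneg
  have key : ∀ x : ℝ, ((j : ℝ) + 1) / 4 ≤ x → ‖1 / x ^ n‖ ≤ 4 ^ n * (1 / (j + 1 : ℝ) ^ n) := by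
    intro x hx
    have h0 : 0 < x := lt_of_lt_of_le (by positivity) hx
    rw [Real.norm_of_nonneg (by positivity)]
    calc 1 / x ^ n ≤ 1 / (((j : ℝ) + 1) / 4) ^ n := by gcongr
      _ = _ := by rw [div_pow]; field_simp
  calc _ ≤ _ := norm_sub_le _ _
    _ ≤ 4 ^ n * (1 / (j + 1 : ℝ) ^ n) + 4 ^ n * (1 / (j + 1 : ℝ) ^ n) :=
        add_le_add (key _ (by linarith)) (key _ (by linarith))
    _ = _ := by ring

lemma summable_one_div_succ_pow {n : ℕ} (hn : 2 ≤ n) :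
    Summable fun j : ℕ => 1 / (j + 1 : ℝ) ^ n := by
  have h := (summable_nat_add_iff 1).2 (Real.summable_one_div_nat_pow.2 hn)
  simpa using h

lemma summable_etaSum {n : ℕ} (hn : 1 ≤ n) {z : ℝ} (hz : -1 / 4 < z) :
    Summable fun j : ℕ => 1 / ((j : ℝ) + 1 / 2 + z) ^ n - 1 / (j + 1 + z) ^ n := by
  rcases hn.eq_or_lt with rfl | hn
  · exact (hasSum_etaSum_one (by linarith)).summable
  · exact ((summable_one_div_succ_pow hn).mul_left _).of_norm_bounded (etaSum_term_norm_le n hz)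

lemma hasDerivAt_etaSum {n : ℕ} (hn : 1 ≤ n) {z : ℝ} (hz : -1 / 4 < z) :
    HasDerivAt (etaSum n) (-n * etaSum (n + 1) z) z := by
  have key := hasDerivAt_tsum_of_isPreconnected (𝕜 := ℝ)
    (g := fun (j : ℕ) z => 1 / ((j : ℝ) + 1 / 2 + z) ^ n - 1 / ((j : ℝ) + 1 + z) ^ n)
    (g' := fun (j : ℕ) z =>
      -n * (1 / ((j : ℝ) + 1 / 2 + z) ^ (n + 1) - 1 / ((j : ℝ) + 1 + z) ^ (n + 1)))
    (((summable_one_div_succ_pow (n := n + 1) (by omega)).mul_left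
      (2 * 4 ^ (n + 1))).mul_left (n : ℝ))
    isOpen_Ioi isPreconnected_Ioi (t := Set.Ioi (-1 / 4)) (y₀ := z) (y := z) (fun j y hy => ?_)
    (fun j y hy => ?_) hz (summable_etaSum hn hz) hz
  · rw [tsum_mul_left] at key
    exact key
  · have hj : (0 : ℝ) ≤ j := j.cast_nonneg
    have hy : -1 / 4 < y := hy
    exact ((hasDerivAt_const_div_add_pow n _ _ _ (by linarith)).sub
      (hasDerivAt_const_div_add_pow n _ _ _ (by linarith))).congr_deriv (by ring)
  · rw [norm_mul, norm_neg, Real.norm_of_nonneg (Nat.cast_nonneg n)]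
    exact mul_le_mul_of_nonneg_left (etaSum_term_norm_le (n + 1) hy j) (Nat.cast_nonneg n)

/-- Half-integers are halved odd numbers, so their sum is 2^n (1 - 2^(-n)) ζ(n). -/
lemma etaSum_zero {n : ℕ} (hn : 2 ≤ n) :
    etaSum n 0 = (2 ^ n - 2) * ∑' j : ℕ, 1 / (j + 1 : ℝ) ^ n := by
  have hs := summable_one_div_succ_pow hn
  have he : Summable fun j : ℕ => 1 / (((2 * j : ℕ) : ℝ) + 1) ^ n :=
    hs.comp_injective (i := fun j : ℕ => 2 * j) (fun a b h => by simpa using h)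
  have ho : Summable fun j : ℕ => 1 / (((2 * j + 1 : ℕ) : ℝ) + 1) ^ n :=
    hs.comp_injective (i := fun j : ℕ => 2 * j + 1) (fun a b h => by simpa using h)
  have h1 := tsum_even_add_odd (f := fun j : ℕ => 1 / ((j : ℝ) + 1) ^ n) he ho
  have hodd : ∀ j : ℕ, 1 / (((2 * j + 1 : ℕ) : ℝ) + 1) ^ n
      = (1 / 2 ^ n) * (1 / (j + 1 : ℝ) ^ n) := by
    intro j
    rw [show (((2 * j + 1 : ℕ) : ℝ) + 1) = 2 * (j + 1) by push_cast; ring, mul_pow]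
    field_simp
  have heven : ∀ j : ℕ, 1 / ((j : ℝ) + 1 / 2 + 0) ^ n
      = 2 ^ n * (1 / (((2 * j : ℕ) : ℝ) + 1) ^ n) := by
    intro j
    rw [show ((j : ℝ) + 1 / 2 + 0) = (((2 * j : ℕ) : ℝ) + 1) / 2 by push_cast; ring, div_pow]
    field_simp
  simp only [hodd, tsum_mul_left] at h1
  have h2 : etaSum n 0 = 2 ^ n * (∑' j : ℕ, 1 / (((2 * j : ℕ) : ℝ) + 1) ^ n)
      - ∑' j : ℕ, 1 / (j + 1 : ℝ) ^ n := by
    rw [← tsum_mul_left, ← (he.mul_left _).tsum_sub hs]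
    simp only [etaSum, heven]
    simp only [add_zero]
  have h3 : (2 : ℝ) ^ n * (1 / 2 ^ n) = 1 := by field_simp
  rw [h2]
  linear_combination 2 ^ n * h1 - (∑' j : ℕ, 1 / (j + 1 : ℝ) ^ n) * h3

lemma etaSum_one_zero : etaSum 1 0 = 2 * Real.log 2 := by
  refine tendsto_nhds_unique (summable_etaSum le_rfl (by norm_num)).hasSum.tendsto_sum_nat ?_
  have hsum : ∀ N : ℕ, ∑ j ∈ Finset.range N,
      (1 / ((j : ℝ) + 1 / 2 + 0) ^ 1 - 1 / (j + 1 + 0) ^ 1)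
      = 2 * ((harmonic (2 * N) : ℝ) - harmonic N) := by
    intro N
    induction N with
    | zero => simp
    | succ N ih =>
      rw [Finset.sum_range_succ, ih, show 2 * (N + 1) = 2 * N + 1 + 1 by ring,
        harmonic_succ, harmonic_succ, harmonic_succ]
      push_cast
      field_simp
      ring
  simp_rw [hsum]
  -- Euler's constant cancels between H_(2N) and H_N, leaving log 2.
  have h1 := Real.tendsto_harmonic_sub_log
  have h2 := h1.comp (tendsto_id.const_mul_atTop' (r := 2) (by norm_num))
  have h3 := ((h2.sub h1).add_const (Real.log 2)).const_mul 2
  rw [sub_self, zero_add] at h3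
  refine h3.congr' ?_
  filter_upwards [eventually_ge_atTop 1] with N hN
  have hN' : (N : ℝ) ≠ 0 := by positivity
  simp only [Function.comp, id]
  push_cast
  rw [Real.log_mul two_ne_zero hN']
  ring

/-! ### Differentiating G' = G E_1 at 0 -/

lemma deriv_eq_of_eq_on_Ioi {f g : ℝ → ℝ} {f' g' a z : ℝ} (hz : a < z)
    (h : ∀ w, a < w → f w = g w) (hf : HasDerivAt f f' z) (hg : HasDerivAt g g' z) : f' = g' :=
  hf.unique (hg.congr_of_eventuallyEq (by filter_upwards [Ioi_mem_nhds hz] with w hw using h w hw))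

lemma binomSum_zero_relations :
    binomSum 1 0 = etaSum 1 0 ∧
    -2 * binomSum 2 0 = binomSum 1 0 * etaSum 1 0 - etaSum 2 0 ∧
    6 * binomSum 3 0 = -2 * binomSum 2 0 * etaSum 1 0 - 2 * binomSum 1 0 * etaSum 2 0
      + 2 * etaSum 3 0 ∧
    -24 * binomSum 4 0 = 6 * binomSum 3 0 * etaSum 1 0 + 6 * binomSum 2 0 * etaSum 2 0
      + 6 * binomSum 1 0 * etaSum 3 0 - 6 * etaSum 4 0 := by
  have hB : ∀ n : ℕ, 1 ≤ n → ∀ z : ℝ, -1 / 4 < z →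
      HasDerivAt (binomSum n) (-n * binomSum (n + 1) z) z :=
    fun n hn z hz => hasDerivAt_binomSum hn (by linarith)
  have B1 := hB 1 le_rfl
  have B2 := hB 2 (by norm_num)
  have B3 := hB 3 (by norm_num)
  have B4 := hB 4 (by norm_num)
  have E1 := fun z hz => hasDerivAt_etaSum (n := 1) le_rfl (z := z) hz
  have E2 := fun z hz => hasDerivAt_etaSum (n := 2) (by norm_num) (z := z) hz
  have E3 := fun z hz => hasDerivAt_etaSum (n := 3) (by norm_num) (z := z) hz
  norm_num at B1 B2 B3 B4 E1 E2 E3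
  -- I0 is G' = G E_1; I1 and I2 are its first two derivatives near 0, and I3 is the third at 0.
  have I0 : ∀ z : ℝ, -(1 / 4) < z →
      binomSum 1 z - z * binomSum 2 z = (1 + z * binomSum 1 z) * etaSum 1 z :=
    fun z hz => gammaQuotientDeriv_eq (by linarith)
  have I1 : ∀ z : ℝ, -(1 / 4) < z →
      -2 * binomSum 2 z + z * (2 * binomSum 3 z) =
        (binomSum 1 z - z * binomSum 2 z) * etaSum 1 z
          - (1 + z * binomSum 1 z) * etaSum 2 z := by
    intro z hz
    have h := deriv_eq_of_eq_on_Ioi hz I0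
      ((B1 z hz).sub ((hasDerivAt_id z).mul (B2 z hz)))
      ((((hasDerivAt_id z).mul (B1 z hz)).const_add 1).mul (E1 z hz))
    simp only [id, Pi.mul_apply] at h
    linear_combination h
  have I2 : ∀ z : ℝ, -(1 / 4) < z →
      6 * binomSum 3 z - z * (6 * binomSum 4 z) =
        (-2 * binomSum 2 z + z * (2 * binomSum 3 z)) * etaSum 1 z
          - 2 * ((binomSum 1 z - z * binomSum 2 z) * etaSum 2 z)
          + 2 * ((1 + z * binomSum 1 z) * etaSum 3 z) := by
    intro z hz
    have h := deriv_eq_of_eq_on_Ioi hz I1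
      (((B2 z hz).const_mul (-2)).add ((hasDerivAt_id z).mul ((B3 z hz).const_mul 2)))
      ((((B1 z hz).sub ((hasDerivAt_id z).mul (B2 z hz))).mul (E1 z hz)).sub
        ((((hasDerivAt_id z).mul (B1 z hz)).const_add 1).mul (E2 z hz)))
    simp only [id, Pi.mul_apply, Pi.sub_apply] at h
    linear_combination h
  have hz : -(1 / 4 : ℝ) < 0 := by norm_num
  have I3 := deriv_eq_of_eq_on_Ioi hz I2
    (((B3 0 hz).const_mul 6).sub ((hasDerivAt_id 0).mul ((B4 0 hz).const_mul 6)))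
    ((((((B2 0 hz).const_mul (-2)).add ((hasDerivAt_id 0).mul ((B3 0 hz).const_mul 2))).mul
        (E1 0 hz)).sub
      ((((B1 0 hz).sub ((hasDerivAt_id 0).mul (B2 0 hz))).mul (E2 0 hz)).const_mul 2)).add
      (((((hasDerivAt_id 0).mul (B1 0 hz)).const_add 1).mul (E3 0 hz)).const_mul 2))
  simp only [Pi.mul_apply, Pi.sub_apply, Pi.add_apply] at I3
  refine ⟨?_, ?_, ?_, ?_⟩
  · linear_combination I0 0 hz
  · linear_combination I1 0 hz
  · linear_combination I2 0 hz
  · linear_combination I3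

lemma binomSum_three_zero : binomSum 3 0 = 2 * (∑' j : ℕ, 1 / (j + 1 : ℝ) ^ 3)
    - 2 * Real.log 2 * (∑' j : ℕ, 1 / (j + 1 : ℝ) ^ 2) + 4 / 3 * Real.log 2 ^ 3 := by
  obtain ⟨h1, h2, h3, -⟩ := binomSum_zero_relations
  rw [etaSum_one_zero] at h1 h2 h3
  rw [etaSum_zero le_rfl] at h2 h3
  rw [etaSum_zero (by norm_num)] at h3
  have h2' : binomSum 2 0 = (∑' j : ℕ, 1 / (j + 1 : ℝ) ^ 2) - 2 * Real.log 2 ^ 2 := by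
    rw [h1] at h2
    linear_combination -h2 / 2
  rw [h1, h2'] at h3
  linear_combination h3 / 6

lemma binomSum_four_zero (hζ : (∑' j : ℕ, 1 / (j + 1 : ℝ) ^ 2) ^ 2
      = 5 / 2 * ∑' j : ℕ, 1 / (j + 1 : ℝ) ^ 4) :
    binomSum 4 0 = 9 / 4 * (∑' j : ℕ, 1 / (j + 1 : ℝ) ^ 4)
    - 4 * Real.log 2 * (∑' j : ℕ, 1 / (j + 1 : ℝ) ^ 3)
    + 2 * Real.log 2 ^ 2 * (∑' j : ℕ, 1 / (j + 1 : ℝ) ^ 2) - 2 / 3 * Real.log 2 ^ 4 := by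
  have h3' := binomSum_three_zero
  obtain ⟨h1, h2, -, h4⟩ := binomSum_zero_relations
  rw [etaSum_one_zero] at h1 h2 h4
  rw [etaSum_zero le_rfl] at h2 h4
  rw [etaSum_zero (by norm_num), etaSum_zero (by norm_num)] at h4
  have h2' : binomSum 2 0 = (∑' j : ℕ, 1 / (j + 1 : ℝ) ^ 2) - 2 * Real.log 2 ^ 2 := by
    rw [h1] at h2
    linear_combination -h2 / 2
  rw [h1, h2', h3'] at h4
  linear_combination -h4 / 24 - hζ / 2

/-! ### Passage to the complex zeta function -/

lemma riemannZeta_eq_ofReal_tsum {n : ℕ} (hn : 2 ≤ n) :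
    riemannZeta n = ((∑' j : ℕ, 1 / (j + 1 : ℝ) ^ n : ℝ) : ℂ) := by
  rw [zeta_nat_eq_tsum_of_gt_one (by omega), Complex.ofReal_tsum]
  have hs : Summable fun j : ℕ => 1 / (j : ℂ) ^ n := by
    have := Complex.summable_ofReal.2 (Real.summable_one_div_nat_pow.2 (show 1 < n by omega))
    simpa using this
  -- The term j = 0 is 1 / 0 = 0.
  rw [hs.tsum_eq_zero_add]
  have : n ≠ 0 := by omega
  simp [this]

lemma hasSum_centralCoeff_div_pow {n : ℕ} (hn : 1 ≤ n) :
    HasSum (fun k : ℕ => 1 / ((k + 1 : ℕ) : ℂ) ^ n * (Nat.choose (2 * (k + 1)) (k + 1) : ℂ)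
        * (1 / 4 ^ (k + 1))) (binomSum n 0 : ℂ) := by
  have h := Complex.hasSum_ofReal.2 (summable_binomSum hn (z := 0) (by norm_num)).hasSum
  convert h using 2 with k
  · simp only [centralCoeff, add_zero]
    push_cast
    field_simp
  · rfl

theorem mainTheorem8 :
    HasSum
      (fun k : ℕ => 1 / ((k + 1 : ℕ) : ℂ) ^ 3 * (Nat.choose (2 * (k + 1)) (k + 1) : ℂ)
        * (1 / 4 ^ (k + 1)))
      (2 * riemannZeta 3 - 2 * (Real.log 2 : ℂ) * riemannZeta 2
        + 4 / 3 * (Real.log 2 : ℂ) ^ 3) ∧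
    HasSum
      (fun k : ℕ => 1 / ((k + 1 : ℕ) : ℂ) ^ 4 * (Nat.choose (2 * (k + 1)) (k + 1) : ℂ)
        * (1 / 4 ^ (k + 1)))
      (9 / 4 * riemannZeta 4 - 4 * (Real.log 2 : ℂ) * riemannZeta 3
        + 2 * (Real.log 2 : ℂ) ^ 2 * riemannZeta 2
        - 2 / 3 * (Real.log 2 : ℂ) ^ 4) := by
  have z2 := riemannZeta_eq_ofReal_tsum (n := 2) le_rfl
  have z3 := riemannZeta_eq_ofReal_tsum (n := 3) (by norm_num)
  have z4 := riemannZeta_eq_ofReal_tsum (n := 4) (by norm_num)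
  norm_num only [Nat.cast_ofNat] at z2 z3 z4
  have hζ : (∑' j : ℕ, 1 / (j + 1 : ℝ) ^ 2) ^ 2 = 5 / 2 * ∑' j : ℕ, 1 / (j + 1 : ℝ) ^ 4 := by
    have h : riemannZeta 2 ^ 2 = 5 / 2 * riemannZeta 4 := by
      rw [riemannZeta_two, riemannZeta_four]
      ring
    rw [z2, z4] at h
    rw [← Complex.ofReal_inj, Complex.ofReal_mul, Complex.ofReal_pow, h]
    norm_num
  rw [z2, z3, z4]
  constructor
  · have h := hasSum_centralCoeff_div_pow (n := 3) (by norm_num)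
    rw [binomSum_three_zero] at h
    convert h using 1
    push_cast
    ring
  · have h := hasSum_centralCoeff_div_pow (n := 4) (by norm_num)
    rw [binomSum_four_zero hζ] at h
    convert h using 1
    push_cast
    ring
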